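/- Let $R$ be a closed region of the Euclidean plane and $\alpha>0$. Travelling costs $\alpha$ per unit of length in the interior of $R$, $1$ outside $R$, and $\min\{1,\alpha\}$ along the boundary of $R$; the weighted length of a rectifiable path is the integral of this cost along it. The Weighted Region Problem with weights $\{1,\alpha\}$ asks, for given points $s,t$, for a shortest path from $s$ to $t$, that is, one of minimum weighted length among all rectifiable paths from $s$ to $t$. An instance is solved exactly in the Algebraic Computation Model over the Rationals (ACM$\mathbb{Q}$) if some shortest path is a polygonal chain all of whose vertices have coordinates obtainable from rational numbers by finitely many operations $+,-,\times,\div$ and $\sqrt[k]{\ }$, $k\ge 2$ (complex intermediate values allowed). **Theorem.** The Weighted Region Problem with weights in $\{1,\alpha\}$, where $0<\alpha<\sqrt2$ and $\alpha\ne1$, cannot be solved exactly in the ACM$\mathbb{Q}$, even if $R$ is a single quadrant. More precisely, there are a rational number $\alpha\in(0,\sqrt2)\setminus\{1\}$, an axis-parallel quadrant $R$ with rational corner, and points $s,t\notin R$ with rational coordinates, such that a polygonal shortest path from $s$ to $t$ exists, but no shortest path from $s$ to $t$ is a polygonal chain all of whose vertices have coordinates computable in the ACM$\mathbb{Q}$.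 The same holds for an axis-parallel rectangle $R$ with rational corners in place of the quadrant. -/

import Mathlib

open Set

noncomputable section

/-- The Euclidean plane. -/
abbrev Plane : Type := EuclideanSpace ℝ (Fin 2)

/-- A point with rational coordinates, as a point of the Euclidean plane. -/
def ratPoint (p : ℚ × ℚ) : Plane := !₂[(p.1 : ℝ), (p.2 : ℝ)]

/-- The closed axis-parallel quadrant whose top-left corner is `O`. -/
def quadrant (O : Plane) : Set Plane := {x | O 0 ≤ x 0 ∧ x 1 ≤ O 1}

/-- The closed axis-parallel rectangle with bottom-left corner `A` and top-right corner `B`. -/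
def rectangle (A B : Plane) : Set Plane :=
  {x | A 0 ≤ x 0 ∧ x 0 ≤ B 0 ∧ A 1 ≤ x 1 ∧ x 1 ≤ B 1}

open Classical in
/-- Cost per unit of Euclidean length at the point `x`, for a region `R` of weight `α` in a plane
that has weight `1` elsewhere; along the boundary of `R` the cheaper of the two weights counts. -/
def regionWeight (R : Set Plane) (α : ℝ) (x : Plane) : ℝ :=
  if x ∈ interior R then α else if x ∈ frontier R then min 1 α else 1

/-- `γ`, restricted to `[0, 1]`, is a rectifiable path from `s` to `t`, in a Lipschitz
parametrization. -/
def IsPathFromTo (s t : Plane) (γ : ℝ → Plane) : Prop :=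
  (∃ K, LipschitzOnWith K γ (Icc 0 1)) ∧ γ 0 = s ∧ γ 1 = t

/-- The weighted length of the path `γ` on `[0, 1]`. -/
def weightedLength (R : Set Plane) (α : ℝ) (γ : ℝ → Plane) : ℝ :=
  ∫ τ in (0 : ℝ)..1, regionWeight R α (γ τ) * ‖deriv γ τ‖

/-- The weighted length of the polygonal chain with the given list of vertices. -/
def chainLength (R : Set Plane) (α : ℝ) : List Plane → ℝ
  | [] => 0
  | [_] => 0
  | p :: q :: l =>
      weightedLength R α (fun τ => AffineMap.lineMap p q τ) + chainLength R α (q :: l)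

/-- The polygonal chain with vertex list `L` is a shortest path from `s` to `t`: it starts at `s`,
ends at `t`, and no rectifiable path from `s` to `t` has smaller weighted length. -/
structure IsShortestChain (R : Set Plane) (α : ℝ) (s t : Plane) (L : List Plane) : Prop where
  head_eq : L.head? = some s
  last_eq : L.getLast? = some t
  le_length : ∀ γ : ℝ → Plane, IsPathFromTo s t γ → chainLength R α L ≤ weightedLength R α γ

/-- A real number is computable in the algebraic computation model over the rationals: it is
obtained from rational numbers by finitely many operations `+`, `-`, `×`, `÷` and `k`-th roots.
The intermediate values may be complex and every complex `k`-th root is admitted. -/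
def ACMComputable (x : ℝ) : Prop := (x : ℂ) ∈ solvableByRad ℚ ℂ

/-- The instance `(R, α, s, t)` of the weighted region problem is solved exactly in the algebraic
computation model over the rationals: some shortest path from `s` to `t` is a polygonal chain all
of whose vertices have computable coordinates. -/
def SolvableInACM (R : Set Plane) (α : ℝ) (s t : Plane) : Prop :=
  ∃ L : List Plane, IsShortestChain R α s t L ∧ ∀ p ∈ L, ∀ i, ACMComputable (p i)

end

/-! The instance is α = 7/5, corner (0, 0), s = (27, 2), t = (-1, -6); one argument serves every
region inside the quadrant whose interior contains the open square of side 100 at the corner. An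
optimal path crosses the top edge, the interior and the left edge. By Snell's law its three legs run
along (-p, -P), (-p, -q) and (-Q, -q), with p² + P² = q² + Q² = 1 and p² + q² = α². Passing through
s and t forces 27/p - 2/P = 6/q - 1/Q. With 50p² = 49 + W this is an equation in W, with a solution
in [7/10, 18/25].

Optimality is proved by calibration: a piecewise linear function whose gradient has norm at most the
local weight bounds every weighted length from below by its increment (`potential_sub_le_integral`),
and the refracted path attains the bound. Near s, equality in Cauchy-Schwarz forces any optimal
chain to start in the direction (-p, -P), so its first vertex other than s determines p², hence W,
by field operations. Uniqueness of the shortest path is not needed.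

W is not expressible by radicals: repeated squaring makes it a root of a polynomial of degree 11,
irreducible over ℚ because it is so modulo 11. If its Galois group were solvable, a nontrivial
element would fix at most one root. Complex conjugation fixes two real roots, W and a negative one,
so all roots would be real; but Laguerre's inequality fails at 45. -/

/-! ### Real roots and solvable Galois groups of prime degree -/

open Polynomial in
/-- Laguerre's inequality for a polynomial all of whose roots are real. -/
theorem laguerre_of_splits {f : ℝ[X]} (hf : f.Splits) (x : ℝ) :
    0 ≤ (derivative f).eval x ^ 2 - f.eval x * (derivative (derivative f)).eval x := by
  have key : ∀ m : Multiset ℝ,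
      0 ≤ (derivative (m.map (X - C ·)).prod).eval x ^ 2 -
        ((m.map (X - C ·)).prod).eval x *
          (derivative (derivative (m.map (X - C ·)).prod)).eval x := by
    intro m
    induction m using Multiset.induction_on with
    | empty => simp
    | cons r m ih =>
      set g := (m.map (X - C ·)).prod
      simp only [Multiset.map_cons, Multiset.prod_cons, derivative_mul, derivative_sub,
        derivative_X, derivative_C, derivative_add, eval_add, eval_mul, eval_sub, eval_X, eval_C,
        sub_zero, one_mul]
      simp only [g] at ih ⊢
      -- With L(f) = f'² - f f'', one has L((X - r) g) = (x - r)² L(g) + g².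
      nlinarith [mul_nonneg (sq_nonneg (x - r)) ih,
        sq_nonneg (eval x ((m.map (X - C ·)).prod))]
  rw [hf.eq_prod_roots]
  have := mul_nonneg (sq_nonneg f.leadingCoeff) (key f.roots)
  simp only [derivative_mul, derivative_C, zero_mul, zero_add, eval_mul, eval_C]
  linarith

namespace MulAction

/-- A solvable group that acts faithfully and transitively on a set of prime cardinality has the
property that a nontrivial element fixes at most one point. -/
theorem eq_one_of_solvable_of_prime_card {G Ω : Type*} [Group G] [MulAction G Ω]
    [FaithfulSMul G Ω] [IsPretransitive G Ω] [hG : Group.IsSolvable G]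
    (hp : (Nat.card Ω).Prime) {g : G} {x y : Ω} (hxy : x ≠ y) (hx : g • x = x)
    (hy : g • y = y) : g = 1 := by
  classical
  have hex : ∃ n, derivedSeries G n = ⊥ := hG.solvable
  -- A is the last nontrivial term of the derived series, hence normal and abelian; it is trivial
  -- only if G is.
  obtain ⟨A, hAn, hAbot, hAcomm⟩ : ∃ A : Subgroup G, A.Normal ∧ (A = ⊥ → g = 1) ∧
      ∀ a ∈ A, ∀ b ∈ A, a * b = b * a := by
    rcases hn : Nat.find hex with _ | n
    · refine ⟨⊥, inferInstance, fun _ => ?_, by simp⟩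
      have h := Nat.find_spec hex
      rw [hn, derivedSeries_zero] at h
      have : g ∈ (⊤ : Subgroup G) := trivial
      rw [h] at this
      simpa using this
    · refine ⟨derivedSeries G n, inferInstance, fun h => ?_, ?_⟩
      · exact absurd h (Nat.find_min hex (by omega))
      · have h := Nat.find_spec hex
        rw [hn, derivedSeries_succ] at h
        intro a ha b hb
        have := (Subgroup.commutator_eq_bot_iff_le_centralizer.mp h) ha
        exact (Subgroup.mem_centralizer_iff.mp this b hb).symm
  by_cases hA : A = ⊥
  · exact hAbot hA
  have prim : ∀ {H : Type _} [Group H] [MulAction H Ω] [IsPretransitive H Ω],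
      IsPreprimitive H Ω := fun {_} => IsPreprimitive.of_prime_card hp
  have := prim (H := G)
  -- A transitive action on a set of prime size is primitive, so a normal subgroup that moves some
  -- point is transitive.
  have hAtr : IsPretransitive A Ω := by
    apply IsQuasiPreprimitive.isPretransitive_of_normal (G := G)
    intro h
    apply hA
    rw [eq_bot_iff]
    intro a ha
    rw [Subgroup.mem_bot]
    apply FaithfulSMul.eq_of_smul_eq_smul (α := Ω)
    intro z
    have hz : z ∈ fixedPoints A Ω := h ▸ trivial
    simpa using hz ⟨a, ha⟩
  have := prim (H := A)
  let B : Subgroup A := (Subgroup.centralizer {g}).subgroupOf A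
  have hBn : B.Normal := ⟨fun b hb a => by
    have : a * b * a⁻¹ = b := by
      rw [mul_inv_eq_iff_eq_mul]
      exact Subtype.ext (hAcomm _ a.2 _ b.2)
    rwa [this]⟩
  -- A transitive abelian group acts regularly: agreement at x propagates along the orbit.
  have hreg : ∀ a ∈ A, ∀ b ∈ A, a • x = b • x → a = b := by
    intro a ha b hb h
    apply FaithfulSMul.eq_of_smul_eq_smul (α := Ω)
    intro z
    obtain ⟨c, rfl⟩ := exists_smul_eq A x z
    change a • (c : G) • x = b • (c : G) • x
    rw [← mul_smul, ← mul_smul, hAcomm a ha c c.2, hAcomm b hb c c.2, mul_smul, mul_smul, h]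
  obtain ⟨a, ha⟩ := exists_smul_eq A x y
  have haB : a ∈ B := by
    rw [Subgroup.mem_subgroupOf, Subgroup.mem_centralizer_singleton_iff]
    -- Since g fixes x and y, the conjugate of a also sends x to y, so regularity makes it equal to
    -- a.
    have h1 : g * a * g⁻¹ = a := by
      apply hreg _ (hAn.conj_mem _ a.2 g) _ a.2
      have hx' : g⁻¹ • x = x := by rw [inv_smul_eq_iff, hx]
      have ha' : (a : G) • x = y := ha
      rw [mul_smul, mul_smul, hx', ha', hy]
    rw [mul_inv_eq_iff_eq_mul] at h1
    exact h1.symm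
  -- B, the part of A commuting with g, is normal in the primitive group A and moves x to y. Being
  -- transitive, it carries the fixed point x of g to every other point.
  have hBtr : IsPretransitive B Ω := by
    apply IsQuasiPreprimitive.isPretransitive_of_normal (G := A)
    intro h
    have hz : x ∈ fixedPoints B Ω := h ▸ trivial
    have := hz ⟨a, haB⟩
    exact hxy (this.symm.trans ha)
  apply FaithfulSMul.eq_of_smul_eq_smul (α := Ω)
  intro z
  obtain ⟨b, rfl⟩ := exists_smul_eq B x z
  have hb : ((b : A) : G) * g = g * ((b : A) : G) := by
    have := b.2
    rw [Subgroup.mem_subgroupOf, Subgroup.mem_centralizer_singleton_iff] at this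
    exact this
  change g • ((b : A) : G) • x = (1 : G) • ((b : A) : G) • x
  rw [← mul_smul, ← hb, mul_smul, hx, one_smul]

end MulAction

section
open Polynomial Polynomial.Gal

attribute [local instance] splits_ℚ_ℂ

/-- If an irreducible rational polynomial of prime degree has solvable Galois group and at least
two real roots, then all its roots are real. -/
theorem splits_real_of_isSolvable_gal {f : ℚ[X]} (hf : Irreducible f) (hdeg : f.natDegree.Prime)
    (hsol : Group.IsSolvable f.Gal) {u v : ℝ} (huv : u ≠ v) (hu : aeval u f = 0)
    (hv : aeval v f = 0) : (f.map (algebraMap ℚ ℝ)).Splits := by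
  have hf0 := hf.ne_zero
  have hcard : (Nat.card (f.rootSet ℂ)).Prime := by
    rw [Nat.card_eq_fintype_card, card_rootSet_eq_natDegree hf.separable
      (splits_ℚ_ℂ (p := f)).out]
    exact hdeg
  have := galAction_isPretransitive f ℂ hf
  have : FaithfulSMul f.Gal (f.rootSet ℂ) := ⟨fun {a b} h => by
    apply galActionHom_injective f ℂ
    ext z
    exact congrArg _ (h z)⟩
  -- Complex conjugation, acting on the complex roots.
  let c : f.Gal := restrict f ℂ (Complex.conjAe.restrictScalars ℚ)
  have hc : ∀ z : f.rootSet ℂ, ((c • z : f.rootSet ℂ) : ℂ) = (starRingEnd ℂ) z := fun z =>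
    restrict_smul _ z
  have hmem : ∀ {r : ℝ}, aeval r f = 0 → (r : ℂ) ∈ f.rootSet ℂ := by
    intro r hr
    rw [mem_rootSet]
    refine ⟨hf0, ?_⟩
    have := aeval_algebraMap_apply ℂ r f
    rw [hr, map_zero] at this
    exact this
  have hone : c = 1 := by
    apply MulAction.eq_one_of_solvable_of_prime_card hcard
      (x := ⟨u, hmem hu⟩) (y := ⟨v, hmem hv⟩)
    · intro h
      exact huv (Complex.ofReal_injective (congrArg Subtype.val h))
    · exact Subtype.ext (by rw [hc]; simp)
    · exact Subtype.ext (by rw [hc]; simp)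
  have hspl : ((f.map (algebraMap ℚ ℝ)).map (algebraMap ℝ ℂ)).Splits := IsAlgClosed.splits _
  apply hspl.of_splits_map_of_injective (algebraMap ℝ ℂ).injective
  intro z hz
  rw [Polynomial.map_map, ← IsScalarTower.algebraMap_eq ℚ ℝ ℂ] at hz
  have hz' : z ∈ f.rootSet ℂ := mem_rootSet.mpr (mem_aroots.mp hz)
  have h := hc ⟨z, hz'⟩
  rw [hone, one_smul] at h
  exact ⟨z.re, (Complex.conj_eq_iff_re.mp h.symm)⟩
end

/-! ### Irreducibility tests -/

section
open Polynomial

/-- Rabin's irreducibility test for polynomials of prime degree over a prime field. -/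
theorem irreducible_of_dvd_X_pow_sub_X {p : ℕ} [Fact p.Prime] {f : (ZMod p)[X]} {d : ℕ}
    (hd : d.Prime) (hdeg : f.natDegree = d) (hroot : ∀ x, f.eval x ≠ 0)
    (hdvd : f ∣ X ^ p ^ d - X) : Irreducible f := by
  obtain ⟨g, hg, hgf⟩ := exists_irreducible_of_natDegree_pos (f := f) (by rw [hdeg]; exact hd.pos)
  have hf0 : f ≠ 0 := by
    rintro rfl
    exact hd.ne_zero (by simpa using hdeg.symm)
  have hgd : g.natDegree ∣ d := by
    apply hg.natDegree_dvd_of_dvd_X_pow_card_pow_sub_X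
    rw [Nat.card_zmod]
    exact hgf.trans hdvd
  rcases (Nat.dvd_prime hd).mp hgd with h1 | h1
  · obtain ⟨x, hx⟩ := exists_root_of_degree_eq_one ((degree_eq_iff_natDegree_eq_of_pos one_pos).mpr h1)
    exact absurd (hx.dvd hgf) (hroot x)
  · exact (associated_of_dvd_of_natDegree_le hgf hf0 (by rw [hdeg, h1])).irreducible hg

/-- A primitive integer polynomial is irreducible over `ℚ` if its reduction modulo a prime that
does not divide the leading coefficient is irreducible. -/
theorem irreducible_map_rat_of_irreducible_map_zmod {p : ℕ} [Fact p.Prime] {f : ℤ[X]}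
    (hf : f.IsPrimitive) (hlead : (f.leadingCoeff : ZMod p) ≠ 0)
    (hirr : Irreducible (f.map (Int.castRingHom (ZMod p)))) :
    Irreducible (f.map (Int.castRingHom ℚ)) := by
  rw [← IsPrimitive.Int.irreducible_iff_irreducible_map_cast hf]
  refine ⟨fun h => hirr.not_isUnit (h.map (mapRingHom (Int.castRingHom (ZMod p)))), ?_⟩
  intro a b hab
  have key : ∀ a b : ℤ[X], f = a * b → IsUnit (a.map (Int.castRingHom (ZMod p))) → IsUnit a := by
    intro a b hab ha
    have hla : (a.leadingCoeff : ZMod p) ≠ 0 := by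
      intro h
      apply hlead
      rw [hab, leadingCoeff_mul]
      push_cast
      rw [h, zero_mul]
    have hdeg : a.natDegree = 0 := by
      rw [← natDegree_map_of_leadingCoeff_ne_zero (Int.castRingHom (ZMod p)) hla]
      exact natDegree_eq_zero_of_isUnit ha
    rw [eq_C_of_natDegree_eq_zero hdeg] at hab ⊢
    exact isUnit_C.mpr (isPrimitive_iff_isUnit_of_C_dvd.mp hf _ ⟨b, hab⟩)
  have hab' := congrArg (map (Int.castRingHom (ZMod p))) hab
  rw [Polynomial.map_mul] at hab'
  rcases hirr.isUnit_or_isUnit hab' with h | h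
  · exact Or.inl (key a b hab h)
  · exact Or.inr (key b a (by rw [hab, mul_comm]) h)

end

/-! ### Arithmetic modulo a polynomial on coefficient lists (highest coefficient first) -/

namespace CoeffList

/-- The value at `θ` of the polynomial with the given coefficients. -/
def value {K : Type*} [CommRing K] (θ : K) : List ℕ → K
  | [] => 0
  | a :: l => a * θ ^ l.length + value θ l

/-- `c * l + m` with coefficients reduced modulo `p`. -/
def mulAdd (p c : ℕ) (l m : List ℕ) : List ℕ := List.zipWith (fun a b => (c * a + b) % p) l m

/-- Multiplication by the variable `X`, where `X ^ r.length` is replaced by `r`. -/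
def mulX (p : ℕ) (r : List ℕ) : List ℕ → List ℕ
  | [] => []
  | h :: t => mulAdd p h r (t ++ [0])

/-- Horner's scheme for `acc * X ^ l.length + l * m`. -/
def mulAcc (p : ℕ) (r m : List ℕ) : List ℕ → List ℕ → List ℕ
  | acc, [] => acc
  | acc, a :: l => mulAcc p r m (mulAdd p a m (mulX p r acc)) l

/-- `m ^ (n + 1)`. -/
def powSucc (p : ℕ) (r m : List ℕ) : ℕ → List ℕ
  | 0 => m
  | n + 1 => mulAcc p r m (List.replicate r.length 0) (powSucc p r m n)

/-- `m ^ ((e + 1) ^ n)`. -/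
def powIter (p : ℕ) (r m : List ℕ) (e : ℕ) : ℕ → List ℕ
  | 0 => m
  | n + 1 => powSucc p r (powIter p r m e n) e

variable {K : Type*} [CommRing K] {θ : K} {p : ℕ} {r : List ℕ}

theorem length_mulAdd {c : ℕ} {l m : List ℕ} (h : l.length = m.length) :
    (mulAdd p c l m).length = m.length := by
  simp [mulAdd, h]

theorem value_mulAdd (hp : (p : K) = 0) (c : ℕ) : ∀ {l m : List ℕ}, l.length = m.length →
    value θ (mulAdd p c l m) = c * value θ l + value θ m
  | [], [], _ => by simp [mulAdd, value]
  | a :: l, b :: m, h => by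
    have hl : l.length = m.length := by simpa using h
    have ih := value_mulAdd hp c hl
    have hcast : (((c * a + b) % p : ℕ) : K) = c * a + b := by
      have := congrArg (Nat.cast (R := K)) (Nat.mod_add_div (c * a + b) p)
      push_cast at this
      rw [hp, zero_mul, add_zero] at this
      exact this
    have hlen : (List.zipWith (fun a b => (c * a + b) % p) l m).length = m.length :=
      length_mulAdd hl
    simp only [mulAdd] at ih
    simp only [mulAdd, List.zipWith_cons_cons, value, ih, hlen, hcast, hl]
    ring

theorem value_append_zero : ∀ l : List ℕ, value θ (l ++ [0]) = θ * value θ l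
  | [] => by simp [value]
  | a :: l => by
    simp only [List.cons_append, value, value_append_zero l, List.length_append, List.length_cons,
      List.length_nil]
    ring

theorem length_mulX {l : List ℕ} (h : l.length = r.length) : (mulX p r l).length = r.length := by
  cases l with
  | nil => simpa [mulX] using h
  | cons a t => simp only [mulX]; rw [length_mulAdd] <;> simp_all

theorem value_mulX (hp : (p : K) = 0) (hr : θ ^ r.length = value θ r) {l : List ℕ}
    (h : l.length = r.length) : value θ (mulX p r l) = θ * value θ l := by
  cases l with
  | nil => simp [mulX, value]
  | cons a t =>
    have hlen : r.length = (t ++ [0]).length := by simp_all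
    have ht : r.length = t.length + 1 := by simp_all
    rw [mulX, value_mulAdd hp _ hlen, ← hr, value_append_zero, value, ht]
    ring

theorem mulAcc_spec (hp : (p : K) = 0) (hr : θ ^ r.length = value θ r) {m : List ℕ}
    (hm : m.length = r.length) : ∀ (l acc : List ℕ), acc.length = r.length →
    (mulAcc p r m acc l).length = r.length ∧
      value θ (mulAcc p r m acc l) = value θ acc * θ ^ l.length + value θ l * value θ m
  | [], acc, h => by simp [mulAcc, value, h]
  | a :: l, acc, h => by
    have h1 : m.length = (mulX p r acc).length := by rw [hm, length_mulX h]
    have h2 : (mulAdd p a m (mulX p r acc)).length = r.length := by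
      rw [length_mulAdd h1, length_mulX h]
    obtain ⟨h3, h4⟩ := mulAcc_spec hp hr hm l _ h2
    refine ⟨h3, ?_⟩
    rw [mulAcc, h4, value_mulAdd hp _ h1, value_mulX hp hr h, value, List.length_cons]
    ring

theorem value_replicate_zero (n : ℕ) : value θ (List.replicate n 0) = 0 := by
  induction n with
  | zero => rfl
  | succ n ih => simp [List.replicate_succ, value, ih]

theorem powSucc_spec (hp : (p : K) = 0) (hr : θ ^ r.length = value θ r) {m : List ℕ}
    (hm : m.length = r.length) (n : ℕ) : (powSucc p r m n).length = r.length ∧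
      value θ (powSucc p r m n) = value θ m ^ (n + 1) := by
  induction n with
  | zero => simp [powSucc, hm]
  | succ n ih =>
    obtain ⟨h1, h2⟩ := mulAcc_spec hp hr hm (powSucc p r m n) (List.replicate r.length 0) (by simp)
    refine ⟨h1, ?_⟩
    rw [powSucc, h2, value_replicate_zero, ih.2]
    ring

theorem powIter_spec (hp : (p : K) = 0) (hr : θ ^ r.length = value θ r) {m : List ℕ}
    (hm : m.length = r.length) (e n : ℕ) : (powIter p r m e n).length = r.length ∧
      value θ (powIter p r m e n) = value θ m ^ (e + 1) ^ n := by
  induction n with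
  | zero => simp [powIter, hm]
  | succ n ih =>
    obtain ⟨h1, h2⟩ := powSucc_spec hp hr ih.1 e
    refine ⟨h1, ?_⟩
    rw [powIter, h2, ih.2, ← pow_mul, pow_succ]

end CoeffList

/-! ### The refraction polynomial is not solvable by radicals -/

section
open Polynomial

/-- The polynomial that governs the refraction angle of the instance under consideration. -/
noncomputable def refractionPoly : ℤ[X] :=
  C 42406625 * X ^ 11 + C (-7507492305) * X ^ 10 + C 496522550743 * X ^ 9
    + C (-14448447469335) * X ^ 8 + C 150854392470378 * X ^ 7 + C 190701200022390 * X ^ 6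
    + C (-284040924861842) * X ^ 5 + C (-307639133128110) * X ^ 4 + C 180329074076453 * X ^ 3
    + C 169612993527915 * X ^ 2 + C (-39312306642357) * X + C (-29957105460555)

theorem natDegree_refractionPoly : refractionPoly.natDegree = 11 := by
  unfold refractionPoly
  compute_degree!

theorem leadingCoeff_refractionPoly : refractionPoly.leadingCoeff = 42406625 := by
  rw [leadingCoeff, natDegree_refractionPoly]
  simp [refractionPoly, coeff_X]

theorem isPrimitive_refractionPoly : refractionPoly.IsPrimitive := by
  intro r hr
  rw [C_dvd_iff_dvd_coeff] at hr
  have h1 : r ∣ 42406625 := by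
    simpa [refractionPoly, coeff_X, coeff_C] using hr 11
  have h2 : r ∣ 496522550743 := by
    simpa [refractionPoly, coeff_X, coeff_C] using hr 9
  have h3 := dvd_gcd h1 h2
  exact isUnit_of_dvd_one (h3.trans (by decide))

/-- The computational core of Rabin's test: X^(11^11) = X modulo 11 and the refraction polynomial.
The first list is the remainder of X^11, the second is X itself. -/
theorem frobenius_iterate_refraction :
    CoeffList.powIter 11 [2, 7, 0, 1, 8, 2, 10, 9, 1, 7, 8] [0, 0, 0, 0, 0, 0, 0, 0, 0, 1, 0] 10 11
      = [0, 0, 0, 0, 0, 0, 0, 0, 0, 1, 0] := by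
  decide +kernel

instance : Fact (Nat.Prime 11) := ⟨by norm_num⟩

theorem irreducible_refractionPoly_zmod :
    Irreducible (refractionPoly.map (Int.castRingHom (ZMod 11))) := by
  apply irreducible_of_dvd_X_pow_sub_X (d := 11) (by norm_num)
  · rw [natDegree_map_of_leadingCoeff_ne_zero, natDegree_refractionPoly]
    rw [leadingCoeff_refractionPoly]
    decide
  · simp only [refractionPoly, Polynomial.map_add, Polynomial.map_mul, Polynomial.map_pow, map_X,
      map_C, eval_add, eval_mul, eval_pow, eval_X, eval_C]
    decide +kernel
  · rw [← AdjoinRoot.mk_eq_zero, map_sub, map_pow, AdjoinRoot.mk_X]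
    set f := refractionPoly.map (Int.castRingHom (ZMod 11)) with hf
    set θ := AdjoinRoot.root f
    have h11 : ((11 : ℕ) : AdjoinRoot f) = 0 := by
      rw [← map_natCast (AdjoinRoot.of f), CharP.cast_eq_zero (ZMod 11) 11, map_zero]
    have hθ : eval₂ (Int.castRingHom (AdjoinRoot f)) θ refractionPoly = 0 := by
      have h : eval₂ (AdjoinRoot.of f) θ f = 0 := AdjoinRoot.eval₂_root f
      rw [← h, RingHom.ext_int (Int.castRingHom (AdjoinRoot f))
        ((AdjoinRoot.of f).comp (Int.castRingHom (ZMod 11)))]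
      exact (eval₂_map _ _ _).symm
    simp only [refractionPoly, eval₂_add, eval₂_mul, eval₂_pow, eval₂_X, eval₂_C] at hθ
    simp only [eq_intCast] at hθ
    push_cast at hθ
    have hr : θ ^ 11 = CoeffList.value θ [2, 7, 0, 1, 8, 2, 10, 9, 1, 7, 8] := by
      simp only [CoeffList.value, List.length]
      push_cast
      -- 7 inverts the leading coefficient modulo 11; the long factor collects the multiples of 11.
      linear_combination 7 * hθ + ((-26986034) * θ ^ 11 + (4777495103) * θ ^ 10 +
        (-315968895928) * θ ^ 9 + (9194466571395) * θ ^ 8 + (-95998249753877) * θ ^ 7 +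
        (-121355309105158) * θ ^ 6 + (180753315821172) * θ ^ 5 + (195770357445160) * θ ^ 4 +
        (-114754865321380) * θ ^ 3 + (-107935541335946) * θ ^ 2 + (25016922408772) * θ ^ 1 +
        (19063612565807) * θ ^ 0) * h11
    have := (CoeffList.powIter_spec (p := 11) h11 (r := [2, 7, 0, 1, 8, 2, 10, 9, 1, 7, 8]) hr
      (m := [0, 0, 0, 0, 0, 0, 0, 0, 0, 1, 0]) rfl 10 11).2
    rw [frobenius_iterate_refraction] at this
    have hv : CoeffList.value θ [0, 0, 0, 0, 0, 0, 0, 0, 0, 1, 0] = θ := by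
      simp [CoeffList.value]
    rw [hv] at this
    rw [sub_eq_zero]
    exact this.symm

theorem irreducible_refractionPoly_rat :
    Irreducible (refractionPoly.map (Int.castRingHom ℚ)) := by
  apply irreducible_map_rat_of_irreducible_map_zmod isPrimitive_refractionPoly (p := 11) ?_
    irreducible_refractionPoly_zmod
  rw [leadingCoeff_refractionPoly]
  decide

theorem aeval_refractionPoly (x : ℝ) : aeval x (refractionPoly.map (Int.castRingHom ℚ)) =
    42406625 * x ^ 11 - 7507492305 * x ^ 10 + 496522550743 * x ^ 9 - 14448447469335 * x ^ 8
      + 150854392470378 * x ^ 7 + 190701200022390 * x ^ 6 - 284040924861842 * x ^ 5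
      - 307639133128110 * x ^ 4 + 180329074076453 * x ^ 3 + 169612993527915 * x ^ 2
      - 39312306642357 * x - 29957105460555 := by
  simp only [refractionPoly, Polynomial.map_add, Polynomial.map_mul, Polynomial.map_pow, map_X,
    map_C, map_add, map_mul, map_pow, aeval_X, aeval_C]
  simp only [eq_intCast, map_intCast]
  push_cast
  ring

/-- Supplies the second real root, besides the positive W, that complex conjugation fixes. -/
theorem exists_neg_root_refractionPoly :
    ∃ x : ℝ, x < 0 ∧ aeval x (refractionPoly.map (Int.castRingHom ℚ)) = 0 := by
  have hcont : ContinuousOn (fun x : ℝ => aeval x (refractionPoly.map (Int.castRingHom ℚ)))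
      (Set.Icc (-1 / 2) 0) := (Polynomial.continuous_aeval _).continuousOn
  have h := intermediate_value_Icc' (by norm_num) hcont
  obtain ⟨x, hx, hx0⟩ := h (show (0 : ℝ) ∈ Set.Icc _ _ by
    constructor <;> simp only [aeval_refractionPoly] <;> norm_num)
  refine ⟨x, lt_of_le_of_ne hx.2 ?_, hx0⟩
  rintro rfl
  simp only [aeval_refractionPoly] at hx0
  norm_num at hx0

theorem not_splits_refractionPoly :
    ¬ ((refractionPoly.map (Int.castRingHom ℚ)).map (algebraMap ℚ ℝ)).Splits := by
  intro h
  have := laguerre_of_splits h 45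
  simp only [refractionPoly, Polynomial.map_add, Polynomial.map_mul, Polynomial.map_pow, map_X,
    map_C, derivative_add, derivative_mul, derivative_X_pow, derivative_C, derivative_X,
    eval_add, eval_mul, eval_pow, eval_X, eval_C, derivative_one, eval_zero, eval_one, zero_mul,
    derivative_zero] at this
  simp only [eq_intCast, map_intCast] at this
  norm_num at this

/-- No positive root of the refraction polynomial can be expressed by radicals. -/
theorem not_ACMComputable_of_refractionPoly {x : ℝ} (hx : 0 < x)
    (hroot : aeval x (refractionPoly.map (Int.castRingHom ℚ)) = 0) : ¬ ACMComputable x := by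
  intro h
  obtain ⟨y, hy, hyroot⟩ := exists_neg_root_refractionPoly
  apply not_splits_refractionPoly
  have hirr := irreducible_refractionPoly_rat
  refine splits_real_of_isSolvable_gal hirr ?_ (isSolvable_gal_of_irreducible h hirr ?_)
    (hy.trans hx).ne hyroot hroot
  · rw [natDegree_map_eq_of_injective (Int.castRingHom ℚ).injective_int, natDegree_refractionPoly]
    norm_num
  · have := aeval_algebraMap_apply ℂ x (refractionPoly.map (Int.castRingHom ℚ))
    rw [hroot, map_zero] at this
    exact this

end

/-! ### The refraction equation -/

/-- Eliminating the square roots from the optimality condition leads to `refractionPoly`. -/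
theorem aeval_refractionPoly_of_optimality {p q P Q W : ℝ} (hp : 0 < p) (hq : 0 < q) (hP : 0 < P)
    (hQ : 0 < Q) (hpW : 50 * p ^ 2 = 49 + W) (hqW : 50 * q ^ 2 = 49 - W) (hPW : 50 * P ^ 2 = 1 - W)
    (hQW : 50 * Q ^ 2 = 1 + W) (hW : W ≠ 0) (h : 27 / p - 6 / q - 2 / P + 1 / Q = 0) :
    Polynomial.aeval W (refractionPoly.map (Int.castRingHom ℚ)) = 0 := by
  have h1 : 27 * (q * P * Q) - 6 * (p * P * Q) - 2 * (p * q * Q) + p * q * P = 0 := by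
    field_simp at h
    linarith
  obtain ⟨a, ha⟩ : ∃ a, a = p ^ 2 := ⟨_, rfl⟩
  obtain ⟨b, hb⟩ : ∃ b, b = q ^ 2 := ⟨_, rfl⟩
  obtain ⟨c, hc⟩ : ∃ c, c = P ^ 2 := ⟨_, rfl⟩
  obtain ⟨d, hd⟩ : ∃ d, d = Q ^ 2 := ⟨_, rfl⟩
  -- Each squaring follows a grouping of terms: first 27qPQ + pqP = 6pPQ + 2pqQ, then the radicals
  -- qP and pQ, and finally the single radical pqPQ.
  have h2 : 729 * (b * c * d) + a * b * c - 36 * (a * c * d) - 4 * (a * b * d)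
      = 24 * (a * d * (q * P)) - 54 * (b * c * (p * Q)) := by
    rw [ha, hb, hc, hd]
    linear_combination (27 * (q * P * Q) + p * q * P + 6 * (p * P * Q) + 2 * (p * q * Q)) * h1
  have h3 : (729 * (b * c * d) + a * b * c - 36 * (a * c * d) - 4 * (a * b * d)) ^ 2
      - 576 * (a ^ 2 * d ^ 2 * (b * c)) - 2916 * (b ^ 2 * c ^ 2 * (a * d))
      = - 2592 * (a * b * c * d * (p * q * P * Q)) := by
    rw [h2, ha, hb, hc, hd]
    ring
  have h4 : ((729 * (b * c * d) + a * b * c - 36 * (a * c * d) - 4 * (a * b * d)) ^ 2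
      - 576 * (a ^ 2 * d ^ 2 * (b * c)) - 2916 * (b ^ 2 * c ^ 2 * (a * d))) ^ 2
      = 2592 ^ 2 * (a * b * c * d) ^ 3 := by
    rw [h3, ha, hb, hc, hd]
    ring
  have ha' : a = (49 + W) / 50 := by linarith
  have hb' : b = (49 - W) / 50 := by linarith
  have hc' : c = (1 - W) / 50 := by linarith
  have hd' : d = (1 + W) / 50 := by linarith
  rw [ha', hb', hc', hd'] at h4
  rw [aeval_refractionPoly]
  have h5 : W * (42406625 * W ^ 11 - 7507492305 * W ^ 10 + 496522550743 * W ^ 9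
      - 14448447469335 * W ^ 8
      + 150854392470378 * W ^ 7 + 190701200022390 * W ^ 6 - 284040924861842 * W ^ 5
      - 307639133128110 * W ^ 4 + 180329074076453 * W ^ 3 + 169612993527915 * W ^ 2
      - 39312306642357 * W - 29957105460555) = 0 := by
    -- 50^12 clears the denominators and 8192 is a common factor of the coefficients. The extra root
    -- W = 0 solves the equation with the sign of 1/Q reversed.
    linear_combination (50 ^ 12 / 8192) * h4
  exact (mul_eq_zero.mp h5).resolve_left hW

/-- The intermediate value theorem on [7/10, 18/25] gives W; rational bounds on the square roots
settle the signs at the endpoints and the positivity of 27/p - 2/P. -/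
theorem exists_refraction_parameters : ∃ p q P Q W : ℝ, 0 < p ∧ 0 < q ∧ 0 < P ∧ 0 < Q ∧
    p ^ 2 + P ^ 2 = 1 ∧ q ^ 2 + Q ^ 2 = 1 ∧ p ^ 2 + q ^ 2 = (7 / 5) ^ 2 ∧
    27 / p - 2 / P = 6 / q - 1 / Q ∧ 0 < 27 / p - 2 / P ∧ 50 * p ^ 2 = 49 + W ∧
    ¬ ACMComputable W := by
  let F : ℝ → ℝ := fun W => 27 / √((49 + W) / 50) - 6 / √((49 - W) / 50) - 2 / √((1 - W) / 50)
    + 1 / √((1 + W) / 50)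
  have hcont : ContinuousOn F (Set.Icc (7 / 10) (18 / 25)) := by
    have hs : ∀ g : ℝ → ℝ, Continuous g → (∀ x ∈ Set.Icc (7 / 10 : ℝ) (18 / 25), 0 < g x) → ∀ c : ℝ,
        ContinuousOn (fun x => c / √(g x)) (Set.Icc (7 / 10) (18 / 25)) := by
      intro g hg hpos c
      apply continuousOn_const.div (hg.sqrt.continuousOn)
      intro x hx
      exact (Real.sqrt_pos.mpr (hpos x hx)).ne'
    refine (((hs _ ?_ ?_ _).sub (hs _ ?_ ?_ _)).sub (hs _ ?_ ?_ _)).add (hs _ ?_ ?_ _)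
    all_goals first
      | fun_prop
      | (intro x hx; have := hx.1; have := hx.2; linarith)
  have bd : ∀ {x c l u : ℝ}, 0 ≤ c → 0 < l → l ^ 2 ≤ x → x ≤ u ^ 2 → 0 < u →
      c / u ≤ c / √x ∧ c / √x ≤ c / l := by
    intro x c l u hc hl h1 h2 hu
    have hx1 : l ≤ √x := Real.le_sqrt_of_sq_le h1
    have hx2 : √x ≤ u := (Real.sqrt_le_left hu.le).mpr h2
    have hx : 0 < √x := hl.trans_le hx1
    exact ⟨div_le_div_of_nonneg_left hc hx hx2, div_le_div_of_nonneg_left hc hl hx1⟩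
  obtain ⟨W, hW, hFW⟩ := intermediate_value_Icc' (by norm_num) hcont
    (show (0 : ℝ) ∈ Set.Icc _ _ by
      constructor
      · have h1 := (bd (x := (49 + 18 / 25) / 50) (c := 27) (l := 0.997) (u := 1)
          (by norm_num) (by norm_num) (by norm_num) (by norm_num) (by norm_num)).2
        have h2 := (bd (x := (49 - 18 / 25) / 50) (c := 6) (l := 0.9) (u := 1)
          (by norm_num) (by norm_num) (by norm_num) (by norm_num) (by norm_num)).1
        have h3 := (bd (x := (1 - 18 / 25) / 50) (c := 2) (l := 0.07) (u := 0.0749)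
          (by norm_num) (by norm_num) (by norm_num) (by norm_num) (by norm_num)).1
        have h4 := (bd (x := (1 + 18 / 25) / 50) (c := 1) (l := 0.185) (u := 0.2)
          (by norm_num) (by norm_num) (by norm_num) (by norm_num) (by norm_num)).2
        simp only [F]
        norm_num at h1 h2 h3 h4 ⊢
        linarith
      · have h1 := (bd (x := (49 + 7 / 10) / 50) (c := 27) (l := 0.9) (u := 0.998)
          (by norm_num) (by norm_num) (by norm_num) (by norm_num) (by norm_num)).1
        have h2 := (bd (x := (49 - 7 / 10) / 50) (c := 6) (l := 0.98) (u := 1)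
          (by norm_num) (by norm_num) (by norm_num) (by norm_num) (by norm_num)).2
        have h3 := (bd (x := (1 - 7 / 10) / 50) (c := 2) (l := 0.0774) (u := 0.08)
          (by norm_num) (by norm_num) (by norm_num) (by norm_num) (by norm_num)).2
        have h4 := (bd (x := (1 + 7 / 10) / 50) (c := 1) (l := 0.18) (u := 0.1845)
          (by norm_num) (by norm_num) (by norm_num) (by norm_num) (by norm_num)).1
        simp only [F]
        norm_num at h1 h2 h3 h4 ⊢
        linarith)
  have hW1 := hW.1
  have hW2 := hW.2
  simp only [F] at hFW
  have sq : ∀ {x : ℝ}, 0 < x → 0 < √x ∧ √x ^ 2 = x := fun h =>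
    ⟨Real.sqrt_pos.mpr h, Real.sq_sqrt h.le⟩
  obtain ⟨p0, p2⟩ := sq (show 0 < (49 + W) / 50 by linarith)
  obtain ⟨q0, q2⟩ := sq (show 0 < (49 - W) / 50 by linarith)
  obtain ⟨P0, P2⟩ := sq (show 0 < (1 - W) / 50 by linarith)
  obtain ⟨Q0, Q2⟩ := sq (show 0 < (1 + W) / 50 by linarith)
  refine ⟨_, _, _, _, W, p0, q0, P0, Q0, by rw [p2, P2]; ring, by rw [q2, Q2]; ring,
    by rw [p2, q2]; ring, by linarith, ?_, by rw [p2]; ring, ?_⟩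
  · have h1 := (bd (x := (49 + W) / 50) (c := 27) (l := 0.9) (u := 0.998)
      (by norm_num) (by norm_num) (by norm_num; linarith) (by norm_num; linarith) (by norm_num)).1
    have h2 := (bd (x := (1 - W) / 50) (c := 2) (l := 0.0745) (u := 0.1)
      (by norm_num) (by norm_num) (by norm_num; linarith) (by norm_num; linarith) (by norm_num)).2
    norm_num at h1 h2 ⊢
    linarith
  · apply not_ACMComputable_of_refractionPoly (by linarith)
    exact aeval_refractionPoly_of_optimality p0 q0 P0 Q0 (by rw [p2]; ring) (by rw [q2]; ring)
      (by rw [P2]; ring) (by rw [Q2]; ring) (by linarith) hFW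

/-! ### Calibration: the lower bound for weighted lengths -/

noncomputable section

open MeasureTheory

/-- Where h ≤ 0 the function max(h, 0) attains its minimum, and where h ≥ 0 so does max(h, 0) - h.
At a zero of h both formulas hold, so a curve running along a kink of the potential needs no
separate treatment. -/
theorem deriv_max_zero {h : ℝ → ℝ} {τ : ℝ} (hh : DifferentiableAt ℝ h τ)
    (hm : DifferentiableAt ℝ (fun s => max (h s) 0) τ) :
    (h τ ≤ 0 → deriv (fun s => max (h s) 0) τ = 0) ∧
      (0 ≤ h τ → deriv (fun s => max (h s) 0) τ = deriv h τ) := by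
  constructor
  · intro h0
    apply IsLocalMin.deriv_eq_zero
    exact Filter.Eventually.of_forall fun s => by simp [max_eq_right h0]
  · intro h0
    have hmin : IsLocalMin (fun s => max (h s) 0 - h s) τ :=
      Filter.Eventually.of_forall fun s => by simp [max_eq_left h0]
    have := hmin.deriv_eq_zero
    rw [deriv_fun_sub hm hh, sub_eq_zero] at this
    exact this

theorem Plane.norm_eq (v : Plane) : ‖v‖ = √(v 0 ^ 2 + v 1 ^ 2) := by
  rw [EuclideanSpace.norm_eq, Fin.sum_univ_two]
  simp

/-- The Cauchy-Schwarz inequality in the plane. -/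
theorem Plane.le_mul_norm {c d w : ℝ} (hw : 0 ≤ w) (h : c ^ 2 + d ^ 2 ≤ w ^ 2) (v : Plane) :
    c * v 0 + d * v 1 ≤ w * ‖v‖ := by
  rw [Plane.norm_eq]
  apply le_of_sq_le_sq _ (by positivity)
  rw [mul_pow, Real.sq_sqrt (by positivity)]
  nlinarith [sq_nonneg (c * v 1 - d * v 0),
    mul_le_mul_of_nonneg_right h (by positivity : 0 ≤ v 0 ^ 2 + v 1 ^ 2)]

theorem regionWeight_of_mem {R : Set Plane} {α : ℝ} {x : Plane} (hx : x ∈ interior R) :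
    regionWeight R α x = α := by
  simp [regionWeight, hx]

theorem regionWeight_of_notMem {R : Set Plane} {α : ℝ} (hα : 1 ≤ α) {x : Plane}
    (hx : x ∉ interior R) : regionWeight R α x = 1 := by
  simp [regionWeight, hx, hα]

theorem one_le_regionWeight {R : Set Plane} {α : ℝ} (hα : 1 ≤ α) (x : Plane) :
    1 ≤ regionWeight R α x := by
  by_cases hx : x ∈ interior R
  · rwa [regionWeight_of_mem hx]
  · rw [regionWeight_of_notMem hα hx]

theorem regionWeight_le {R : Set Plane} {α : ℝ} (hα : 1 ≤ α) (x : Plane) :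
    regionWeight R α x ≤ α := by
  by_cases hx : x ∈ interior R
  · rw [regionWeight_of_mem hx]
  · rwa [regionWeight_of_notMem hα hx]

theorem measurable_regionWeight (R : Set Plane) (α : ℝ) : Measurable (regionWeight R α) := by
  classical
  have h : regionWeight R α = fun x => if x ∈ interior R then α else
      if x ∈ frontier R then min 1 α else 1 := by
    funext x
    unfold regionWeight
    congr
  rw [h]
  exact Measurable.ite isOpen_interior.measurableSet measurable_const
    (Measurable.ite isClosed_frontier.measurableSet measurable_const measurable_const)

theorem intervalIntegrable_regionWeight {R : Set Plane} {α : ℝ} (hα : 1 ≤ α) {γ : ℝ → Plane}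
    {a b : ℝ} (hab : a ≤ b) {K : NNReal} (hγ : LipschitzOnWith K γ (Icc a b)) :
    IntervalIntegrable (fun τ => regionWeight R α (γ τ) * ‖deriv γ τ‖) volume a b := by
  rw [intervalIntegrable_iff_integrableOn_Ioo_of_le hab]
  refine Integrable.of_bound ?_ (α * K) ?_
  · apply AEMeasurable.aestronglyMeasurable
    refine ((measurable_regionWeight R α).comp_aemeasurable ?_).mul
      (measurable_deriv γ).norm.aemeasurable
    exact (hγ.continuousOn.mono Ioo_subset_Icc_self).aemeasurable measurableSet_Ioo
  · filter_upwards [ae_restrict_mem measurableSet_Ioo] with τ hτ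
    have h1 : ‖deriv γ τ‖ ≤ K := norm_deriv_le_of_lipschitzOn (Icc_mem_nhds hτ.1 hτ.2) hγ
    have h2 := one_le_regionWeight (R := R) hα (γ τ)
    rw [norm_mul, norm_norm, Real.norm_of_nonneg (by linarith)]
    exact mul_le_mul (regionWeight_le hα _) h1 (norm_nonneg _) (by linarith)

/-- A piecewise linear function that calibrates the refracted path. -/
def potential (p q P Q M : ℝ) (z : Plane) : ℝ :=
  (-Q * z 0 + (Q - p) * max (z 0) 0 + p * max (z 0 - M) 0) +
    (-P * z 1 + (q - P) * max (-z 1) 0 + (-q) * max (-z 1 - M) 0)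

/-- The potential has x-slopes -Q, -p, 0 on x < 0, 0 < x < M, x > M and y-slopes -P, -q, 0 on y > 0,
-M < y < 0, y < -M. Its gradient has norm α on the open square at the corner and at most 1 elsewhere
(P² + Q² = 2 - α² ≤ 1), so the chain rule and Cauchy-Schwarz give the bound almost everywhere in
time. Flatness beyond M lets the region be bounded or not. -/
theorem potential_sub_le_integral {p q P Q M α : ℝ}
    (hM : 0 < M) (hα : 1 ≤ α) (hpP : p ^ 2 + P ^ 2 = 1) (hqQ : q ^ 2 + Q ^ 2 = 1)
    (hpq : p ^ 2 + q ^ 2 = α ^ 2) {R : Set Plane}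
    (hR : ∀ x : Plane, 0 < x 0 → x 0 < M → -M < x 1 → x 1 < 0 → x ∈ interior R)
    {γ : ℝ → Plane} {a b : ℝ} (hab : a ≤ b) {K : NNReal} (hγ : LipschitzOnWith K γ (Icc a b)) :
    potential p q P Q M (γ b) - potential p q P Q M (γ a) ≤
      ∫ τ in a..b, regionWeight R α (γ τ) * ‖deriv γ τ‖ := by
  have hproj : ∀ i : Fin 2, LipschitzOnWith (‖(EuclideanSpace.proj i : Plane →L[ℝ] ℝ)‖₊ * K)
      (fun τ => γ τ i) (Icc a b) := fun i =>
    (EuclideanSpace.proj i : Plane →L[ℝ] ℝ).lipschitz.comp_lipschitzOnWith hγ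
  have ac : ∀ {g : ℝ → ℝ} {L : NNReal}, LipschitzOnWith L g (Icc a b) →
      AbsolutelyContinuousOnInterval g a b := fun h =>
    LipschitzOnWith.absolutelyContinuousOnInterval (by rwa [uIcc_of_le hab])
  have lipmax : ∀ {g : ℝ → ℝ} {L : NNReal}, LipschitzOnWith L g (Icc a b) →
      AbsolutelyContinuousOnInterval (fun τ => max (g τ) 0) a b := fun h =>
    ac ((LipschitzWith.id.max_const 0).comp_lipschitzOnWith h)
  have lipsub : ∀ {g : ℝ → ℝ} {L : NNReal} (c : ℝ), LipschitzOnWith L g (Icc a b) →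
      LipschitzOnWith L (fun τ => g τ - c) (Icc a b) := by
    intro g L c h x hx y hy
    simpa [edist_sub_right] using h hx hy
  have hx1 := lipmax (hproj 0)
  have hx2 := lipmax (lipsub M (hproj 0))
  have hy1 := lipmax (hproj 1).neg
  have hy2 := lipmax (lipsub M (hproj 1).neg)
  have hac : AbsolutelyContinuousOnInterval (fun τ => potential p q P Q M (γ τ)) a b :=
    (((((ac (hproj 0)).const_mul (-Q)).add (hx1.const_mul (Q - p))).add (hx2.const_mul p)).add
      ((((ac (hproj 1)).const_mul (-P)).add (hy1.const_mul (q - P))).add (hy2.const_mul (-q))))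
  rw [← hac.integral_deriv_eq_sub]
  apply intervalIntegral.integral_mono_ae_restrict hab hac.intervalIntegrable_deriv
    (intervalIntegrable_regionWeight hα hab hγ)
  have hne : ∀ c : ℝ, ∀ᵐ τ : ℝ, τ ≠ c := fun c => by
    simp [ae_iff]
  rw [Filter.EventuallyLE, ae_restrict_iff' measurableSet_Icc]
  filter_upwards [hγ.ae_differentiableWithinAt_of_mem_real, hx1.ae_differentiableAt,
    hx2.ae_differentiableAt, hy1.ae_differentiableAt, hy2.ae_differentiableAt, hne a, hne b]
    with τ dγ dx1 dx2 dy1 dy2 hτa hτb hτ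
  rw [uIcc_of_le hab] at dx1 dx2 dy1 dy2
  have dγ : DifferentiableAt ℝ γ τ := (dγ hτ).differentiableAt
    (Icc_mem_nhds (lt_of_le_of_ne hτ.1 (Ne.symm hτa)) (lt_of_le_of_ne hτ.2 hτb))
  replace dx1 := dx1 hτ
  replace dx2 := dx2 hτ
  replace dy1 := dy1 hτ
  replace dy2 := dy2 hτ
  have hcoord : ∀ i, HasDerivAt (fun s => γ s i) (deriv γ τ i) τ := fun i =>
    (EuclideanSpace.proj i : Plane →L[ℝ] ℝ).hasFDerivAt.comp_hasDerivAt τ dγ.hasDerivAt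
  have hX := hcoord 0
  have hY := hcoord 1
  set v := deriv γ τ
  have hXM : HasDerivAt (fun s => γ s 0 - M) (v 0) τ := hX.sub_const M
  have hYn : HasDerivAt (fun s => -γ s 1) (-v 1) τ := hY.neg
  have hYM : HasDerivAt (fun s => -γ s 1 - M) (-v 1) τ := hYn.sub_const M
  have m1 := deriv_max_zero hX.differentiableAt dx1
  have m2 := deriv_max_zero hXM.differentiableAt dx2
  have n1 := deriv_max_zero hYn.differentiableAt dy1
  have n2 := deriv_max_zero hYM.differentiableAt dy2
  rw [hX.deriv] at m1
  rw [hXM.deriv] at m2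
  rw [hYn.deriv] at n1
  rw [hYM.deriv] at n2
  have hD : HasDerivAt (fun s => potential p q P Q M (γ s)) _ τ :=
    (((hX.const_mul (-Q)).add (dx1.hasDerivAt.const_mul (Q - p))).add
      (dx2.hasDerivAt.const_mul p)).add
    (((hY.const_mul (-P)).add (dy1.hasDerivAt.const_mul (q - P))).add
      (dy2.hasDerivAt.const_mul (-q)))
  rw [hD.deriv]
  generalize deriv (fun s => max (γ s 0) 0) τ = e1 at *
  generalize deriv (fun s => max (γ s 0 - M) 0) τ = e2 at *
  generalize deriv (fun s => max (-γ s 1) 0) τ = e3 at *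
  generalize deriv (fun s => max (-γ s 1 - M) 0) τ = e4 at *
  have hx : ∃ c : ℝ, -Q * v 0 + (Q - p) * e1 + p * e2 = c * v 0 ∧
      (γ τ 0 ≤ 0 ∧ c = -Q ∨ 0 < γ τ 0 ∧ γ τ 0 < M ∧ c = -p ∨ M ≤ γ τ 0 ∧ c = 0) := by
    rcases le_or_gt (γ τ 0) 0 with h | h
    · exact ⟨-Q, by rw [m1.1 h, m2.1 (by linarith)]; ring, Or.inl ⟨h, rfl⟩⟩
    rcases lt_or_ge (γ τ 0) M with h' | h'
    · exact ⟨-p, by rw [m1.2 h.le, m2.1 (by linarith)]; ring, Or.inr (Or.inl ⟨h, h', rfl⟩)⟩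
    · exact ⟨0, by rw [m1.2 h.le, m2.2 (by linarith)]; ring, Or.inr (Or.inr ⟨h', rfl⟩)⟩
  have hy : ∃ d : ℝ, -P * v 1 + (q - P) * e3 + (-q) * e4 = d * v 1 ∧
      (0 ≤ γ τ 1 ∧ d = -P ∨ γ τ 1 < 0 ∧ -M < γ τ 1 ∧ d = -q ∨ γ τ 1 ≤ -M ∧ d = 0) := by
    rcases le_or_gt 0 (γ τ 1) with h | h
    · exact ⟨-P, by rw [n1.1 (by linarith), n2.1 (by linarith)]; ring, Or.inl ⟨h, rfl⟩⟩
    rcases lt_or_ge (-M) (γ τ 1) with h' | h'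
    · exact ⟨-q, by rw [n1.2 (by linarith), n2.1 (by linarith)]; ring, Or.inr (Or.inl ⟨h, h', rfl⟩)⟩
    · exact ⟨0, by rw [n1.2 (by linarith), n2.2 (by linarith)]; ring, Or.inr (Or.inr ⟨h', rfl⟩)⟩
  obtain ⟨c, hc, hc'⟩ := hx
  obtain ⟨d, hd, hd'⟩ := hy
  rw [hc, hd]
  have hα2 : 1 ≤ α ^ 2 := one_le_pow₀ hα
  have hw := one_le_regionWeight (R := R) hα (γ τ)
  suffices h : c ^ 2 + d ^ 2 ≤ regionWeight R α (γ τ) ^ 2 from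
    Plane.le_mul_norm (by linarith) h v
  have hw2 : 1 ≤ regionWeight R α (γ τ) ^ 2 := one_le_pow₀ hw
  rcases hc' with ⟨_, rfl⟩ | ⟨hx0, hxM, rfl⟩ | ⟨_, rfl⟩ <;>
    rcases hd' with ⟨_, rfl⟩ | ⟨hy0, hyM, rfl⟩ | ⟨_, rfl⟩
  -- The only zone where the gradient may exceed 1, and there the weight is α.
  case inr.inl.inr.inl => rw [regionWeight_of_mem (hR _ hx0 hxM hyM hy0), ← hpq]; linarith
  all_goals nlinarith

/-! ### Weighted length of explicit paths -/

theorem integral_regionWeight_of_const {R : Set Plane} {α c : ℝ} {γ : ℝ → Plane} {v : Plane}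
    {a b : ℝ} (hab : a ≤ b)
    (h : ∀ τ ∈ Ioo a b, regionWeight R α (γ τ) = c ∧ HasDerivAt γ v τ) :
    ∫ τ in a..b, regionWeight R α (γ τ) * ‖deriv γ τ‖ = (b - a) * (c * ‖v‖) := by
  rw [intervalIntegral.integral_of_le hab, integral_Ioc_eq_integral_Ioo,
    setIntegral_congr_fun (g := fun _ => c * ‖v‖) measurableSet_Ioo fun τ hτ => by
      simp only [(h τ hτ).1, (h τ hτ).2.deriv]]
  simp [hab]

theorem hasDerivAt_lineMap (x y : Plane) (τ : ℝ) :
    HasDerivAt (fun τ => AffineMap.lineMap x y τ : ℝ → Plane) (y - x) τ := by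
  simpa using AffineMap.hasDerivAt_lineMap (a := x) (b := y) (x := τ)

theorem lineMap_coord (x y : Plane) (τ : ℝ) (i : Fin 2) :
    (AffineMap.lineMap x y τ : Plane) i = x i + τ * (y i - x i) := by
  simp [AffineMap.lineMap_apply, add_comm]

theorem weightedLength_segment_of_const {R : Set Plane} {α c : ℝ} {x y : Plane}
    (h : ∀ τ ∈ Ioo (0 : ℝ) 1, regionWeight R α (AffineMap.lineMap x y τ) = c) :
    weightedLength R α (fun τ => AffineMap.lineMap x y τ) = c * ‖y - x‖ := by
  rw [weightedLength, integral_regionWeight_of_const (c := c) (v := y - x) zero_le_one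
    fun τ hτ => ⟨h τ hτ, hasDerivAt_lineMap x y τ⟩]
  ring

/-- A path that traverses three segments at constant speeds. -/
def threeSegments (a b c d : Plane) (τ : ℝ) : Plane :=
  a + (max 0 (min 1 (3 * τ)) • (b - a) + (max 0 (min 1 (3 * τ - 1)) • (c - b)
    + max 0 (min 1 (3 * τ - 2)) • (d - c)))

theorem isPathFromTo_threeSegments (a b c d : Plane) : IsPathFromTo a d (threeSegments a b c d) := by
  refine ⟨?_, ?_, ?_⟩
  · have hclamp : ∀ k : ℝ, ∃ K, LipschitzWith K fun τ : ℝ => max 0 (min 1 (3 * τ - k)) := by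
      intro k
      refine ⟨_, LipschitzWith.const_max (LipschitzWith.const_min
        (LipschitzWith.of_dist_le_mul (K := 3) fun x y => ?_) 1) 0⟩
      rw [Real.dist_eq, Real.dist_eq, show 3 * x - k - (3 * y - k) = 3 * (x - y) by ring, abs_mul]
      simp
    have hsmul : ∀ (k : ℝ) (v : Plane), ∃ K,
        LipschitzWith K fun τ : ℝ => max 0 (min 1 (3 * τ - k)) • v := by
      intro k v
      obtain ⟨K, hK⟩ := hclamp k
      exact ⟨_, (ContinuousLinearMap.toSpanSingleton ℝ v).lipschitz.comp hK⟩
    obtain ⟨K1, h1⟩ := hsmul 0 (b - a)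
    obtain ⟨K2, h2⟩ := hsmul 1 (c - b)
    obtain ⟨K3, h3⟩ := hsmul 2 (d - c)
    simp only [sub_zero] at h1
    exact ⟨_, ((LipschitzWith.const a).add (h1.add (h2.add h3))).lipschitzOnWith⟩
  · simp [threeSegments]
  · norm_num [threeSegments]

theorem weightedLength_threeSegments {R : Set Plane} {α w₁ w₂ w₃ : ℝ} (hα : 1 ≤ α)
    {a b c d : Plane} (h₁ : ∀ τ ∈ Ioo (0 : ℝ) 1, regionWeight R α (AffineMap.lineMap a b τ) = w₁)
    (h₂ : ∀ τ ∈ Ioo (0 : ℝ) 1, regionWeight R α (AffineMap.lineMap b c τ) = w₂)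
    (h₃ : ∀ τ ∈ Ioo (0 : ℝ) 1, regionWeight R α (AffineMap.lineMap c d τ) = w₃) :
    weightedLength R α (threeSegments a b c d) = w₁ * ‖b - a‖ + w₂ * ‖c - b‖ + w₃ * ‖d - c‖ := by
  have piece : ∀ (k w : ℝ) (x y : Plane),
      (∀ τ ∈ Ioo (0 : ℝ) 1, regionWeight R α (AffineMap.lineMap x y τ) = w) →
      (∀ τ ∈ Ioo (k / 3) ((k + 1) / 3),
        threeSegments a b c d τ = AffineMap.lineMap x y (3 * τ - k)) →
      ∫ τ in k / 3..(k + 1) / 3, regionWeight R α (threeSegments a b c d τ) *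
        ‖deriv (threeSegments a b c d) τ‖ = w * ‖y - x‖ := by
    intro k w x y hw heq
    rw [integral_regionWeight_of_const (c := w) (v := (3 : ℝ) • (y - x)) (by linarith)]
    · rw [norm_smul]
      norm_num
      ring
    · intro τ hτ
      refine ⟨?_, ?_⟩
      · rw [heq τ hτ]
        exact hw _ ⟨by linarith [hτ.1], by linarith [hτ.2]⟩
      · have h1 : HasDerivAt (fun τ : ℝ => 3 * τ - k) 3 τ := by
          simpa using ((hasDerivAt_id τ).const_mul 3).sub_const k
        have h2 := (hasDerivAt_lineMap x y (3 * τ - k)).scomp τ h1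
        exact h2.congr_of_eventuallyEq
          (Filter.eventually_of_mem (Ioo_mem_nhds hτ.1 hτ.2) heq)
  obtain ⟨⟨K, hK⟩, -, -⟩ := isPathFromTo_threeSegments a b c d
  have hint := intervalIntegrable_regionWeight (R := R) hα zero_le_one hK
  have sub : ∀ x y : ℝ, 0 ≤ x → x ≤ y → y ≤ 1 → IntervalIntegrable (fun τ =>
      regionWeight R α (threeSegments a b c d τ) * ‖deriv (threeSegments a b c d) τ‖) volume x y :=
    fun x y hx hxy hy => hint.mono_set (by
      rw [uIcc_of_le hxy, uIcc_of_le zero_le_one]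
      exact Icc_subset_Icc hx hy)
  rw [weightedLength, ← intervalIntegral.integral_add_adjacent_intervals
    (sub 0 (2 / 3) le_rfl (by norm_num) (by norm_num))
    (sub (2 / 3) 1 (by norm_num) (by norm_num) le_rfl),
    ← intervalIntegral.integral_add_adjacent_intervals
    (sub 0 (1 / 3) le_rfl (by norm_num) (by norm_num))
    (sub (1 / 3) (2 / 3) (by norm_num) (by norm_num) (by norm_num))]
  have e1 := piece 0 w₁ a b h₁ fun τ hτ => by
    have h1 := hτ.1
    have h2 := hτ.2
    rw [threeSegments, min_eq_right (by linarith), max_eq_right (by linarith),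
      max_eq_left (min_le_of_right_le (by linarith)), max_eq_left (min_le_of_right_le (by linarith)),
      AffineMap.lineMap_apply]
    simp [add_comm]
  have e2 := piece 1 w₂ b c h₂ fun τ hτ => by
    have h1 := hτ.1
    have h2 := hτ.2
    rw [threeSegments, min_eq_left (by linarith), max_eq_right zero_le_one,
      min_eq_right (by linarith), max_eq_right (by linarith),
      max_eq_left (min_le_of_right_le (by linarith)), AffineMap.lineMap_apply]
    simp only [one_smul, zero_smul, add_zero, vsub_eq_sub, vadd_eq_add]
    abel
  have e3 := piece 2 w₃ c d h₃ fun τ hτ => by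
    have h1 := hτ.1
    have h2 := hτ.2
    rw [threeSegments, min_eq_left (by linarith), max_eq_right zero_le_one,
      min_eq_left (by linarith), max_eq_right zero_le_one,
      min_eq_right (by linarith), max_eq_right (by linarith), AffineMap.lineMap_apply]
    simp only [one_smul, vsub_eq_sub, vadd_eq_add]
    abel
  norm_num at e1 e2 e3
  rw [e1, e2, e3]

theorem lipschitzOnWith_lineMap (x y : Plane) (s : Set ℝ) :
    ∃ K, LipschitzOnWith K (fun τ => AffineMap.lineMap x y τ : ℝ → Plane) s :=
  ⟨_, (lipschitzWith_lineMap x y).lipschitzOnWith⟩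

/-! ### Rigidity of optimal chains -/

/-- `φ` is a lower bound for weighted lengths: it grows along every Lipschitz arc by at most the
weighted length of the arc. -/
def Calibrates (R : Set Plane) (α : ℝ) (φ : Plane → ℝ) : Prop :=
  ∀ (γ : ℝ → Plane) (a b : ℝ), a ≤ b → (∃ K, LipschitzOnWith K γ (Icc a b)) →
    φ (γ b) - φ (γ a) ≤ ∫ τ in a..b, regionWeight R α (γ τ) * ‖deriv γ τ‖

namespace Calibrates

variable {R : Set Plane} {α : ℝ} {φ : Plane → ℝ}

theorem sub_le_weightedLength (h : Calibrates R α φ) {s t : Plane} {γ : ℝ → Plane}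
    (hγ : IsPathFromTo s t γ) : φ t - φ s ≤ weightedLength R α γ := by
  have := h γ 0 1 zero_le_one hγ.1
  rwa [hγ.2.1, hγ.2.2] at this

theorem sub_le_segment (h : Calibrates R α φ) (x y : Plane) :
    φ y - φ x ≤ weightedLength R α (fun τ => AffineMap.lineMap x y τ) :=
  h.sub_le_weightedLength ⟨lipschitzOnWith_lineMap x y _, by simp, by simp⟩

theorem sub_le_chainLength (h : Calibrates R α φ) {t : Plane} :
    ∀ (l : List Plane) (x : Plane), (x :: l).getLast? = some t →
      φ t - φ x ≤ chainLength R α (x :: l)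
  | [], x, ht => by
    obtain rfl : x = t := by simpa using ht
    simp [chainLength]
  | y :: l, x, ht => by
    have h1 := h.sub_le_chainLength l y (by simpa using ht)
    have h2 := h.sub_le_segment x y
    rw [chainLength]
    linarith

/-- A chain that is calibrated by `φ` has a first vertex different from its starting point, and the
segment to this vertex is calibrated, too. -/
theorem exists_tight_segment (h : Calibrates R α φ) {s t : Plane} (hst : s ≠ t) :
    ∀ l : List Plane, (s :: l).getLast? = some t → chainLength R α (s :: l) ≤ φ t - φ s →
      ∃ v ∈ l, v ≠ s ∧ weightedLength R α (fun τ => AffineMap.lineMap s v τ) ≤ φ v - φ s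
  | [], ht, _ => absurd (by simpa using ht) hst
  | y :: l, ht, hl => by
    rw [chainLength] at hl
    have hlast : (y :: l).getLast? = some t := by simpa using ht
    have h1 := h.sub_le_chainLength l y hlast
    by_cases hy : y = s
    · subst hy
      have h2 := h.sub_le_segment y y
      obtain ⟨v, hv, hv'⟩ := h.exists_tight_segment hst l hlast (by linarith)
      exact ⟨v, List.mem_cons_of_mem _ hv, hv'⟩
    · exact ⟨y, List.mem_cons_self, hy, by linarith⟩

end Calibrates

/-- A calibrated segment that starts above the region has the direction of the gradient. -/
theorem direction_of_tight_segment {p q P Q M α : ℝ} (hα : 1 ≤ α) (hpP : p ^ 2 + P ^ 2 = 1)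
    {R : Set Plane} (hR : ∀ x ∈ interior R, x 1 < 0)
    (hcal : Calibrates R α (potential p q P Q M)) {s v : Plane} (hs0 : 0 < s 0) (hsM : s 0 < M)
    (hs1 : 0 < s 1)
    (h : weightedLength R α (fun τ => AffineMap.lineMap s v τ) ≤
      potential p q P Q M v - potential p q P Q M s) :
    p * (v 1 - s 1) = P * (v 0 - s 0) := by
  set γ : ℝ → Plane := fun τ => AffineMap.lineMap s v τ with hγ
  have hcont : ∀ i, Continuous fun τ => γ τ i := fun i => by
    simp only [hγ, lineMap_coord]
    fun_prop
  have hev : ∀ᶠ τ in nhds (0 : ℝ), 0 < γ τ 0 ∧ γ τ 0 < M ∧ 0 < γ τ 1 := by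
    refine ((hcont 0).continuousAt.eventually_const_lt ?_).and
      (((hcont 0).continuousAt.eventually_lt_const ?_).and
        ((hcont 1).continuousAt.eventually_const_lt ?_)) <;> simpa [hγ]
  obtain ⟨ε, hε, hball⟩ := Metric.eventually_nhds_iff.mp hev
  set δ := min (ε / 2) 1 with hδ
  have hδ0 : 0 < δ := by positivity
  have hδ1 : δ ≤ 1 := min_le_right _ _
  have hin : ∀ τ, 0 ≤ τ → τ ≤ δ → 0 < γ τ 0 ∧ γ τ 0 < M ∧ 0 < γ τ 1 := by
    intro τ h0 h1
    apply hball
    rw [Real.dist_eq, sub_zero, abs_of_nonneg h0]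
    have := min_le_left (ε / 2) 1
    linarith
  obtain ⟨K, hK⟩ := lipschitzOnWith_lineMap s v (Icc 0 1)
  have hint := intervalIntegrable_regionWeight (R := R) hα zero_le_one hK
  have hsub : ∀ x y : ℝ, 0 ≤ x → x ≤ y → y ≤ 1 → IntervalIntegrable (fun τ =>
      regionWeight R α (γ τ) * ‖deriv γ τ‖) volume x y :=
    fun x y hx hxy hy => hint.mono_set (by
      rw [uIcc_of_le hxy, uIcc_of_le zero_le_one]
      exact Icc_subset_Icc hx hy)
  -- On [0, δ] the segment stays where the weight is 1 and the potential is -px - Py. The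
  -- calibration bound on [δ, 1] leaves no slack for this initial piece.
  rw [weightedLength, ← intervalIntegral.integral_add_adjacent_intervals
    (hsub 0 δ le_rfl hδ0.le hδ1) (hsub δ 1 hδ0.le hδ1 le_rfl),
    integral_regionWeight_of_const (c := 1) (v := v - s) hδ0.le fun τ hτ =>
      ⟨regionWeight_of_notMem hα fun hmem =>
        (hR _ hmem).not_gt (hin τ hτ.1.le hτ.2.le).2.2, hasDerivAt_lineMap s v τ⟩] at h
  have h1 := hcal γ δ 1 hδ1 (lipschitzOnWith_lineMap s v _)
  have hγ1 : γ 1 = v := by simp [hγ]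
  rw [hγ1] at h1
  have hpot : ∀ z : Plane, 0 < z 0 → z 0 < M → 0 < z 1 → 0 < M →
      potential p q P Q M z = -p * z 0 - P * z 1 := by
    intro z h0 h2 h3 hM
    rw [potential, max_eq_left h0.le, max_eq_right (by linarith), max_eq_right (by linarith),
      max_eq_right (by linarith)]
    ring
  obtain ⟨i0, i1, i2⟩ := hin δ hδ0.le le_rfl
  rw [hpot _ hs0 hsM hs1 (by linarith)] at h
  rw [hpot _ i0 i1 i2 (by linarith)] at h1
  simp only [hγ, lineMap_coord] at h1
  have hn : ‖v - s‖ ≤ -(p * (v 0 - s 0) + P * (v 1 - s 1)) := by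
    have : δ * ‖v - s‖ ≤ δ * -(p * (v 0 - s 0) + P * (v 1 - s 1)) := by linarith
    exact le_of_mul_le_mul_left this hδ0
  have hsq : ‖v - s‖ ^ 2 = (v 0 - s 0) ^ 2 + (v 1 - s 1) ^ 2 := by
    rw [Plane.norm_eq, Real.sq_sqrt (by positivity)]
    simp
  have hle : ‖v - s‖ ^ 2 ≤ (p * (v 0 - s 0) + P * (v 1 - s 1)) ^ 2 := by
    rw [← neg_sq (p * (v 0 - s 0) + P * (v 1 - s 1))]
    exact pow_le_pow_left₀ (norm_nonneg _) hn 2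
  -- Equality in Cauchy-Schwarz, through Lagrange's identity.
  have hz : (p * (v 1 - s 1) - P * (v 0 - s 0)) ^ 2 ≤ 0 := by
    rw [hsq] at hle
    have : (p * (v 1 - s 1) - P * (v 0 - s 0)) ^ 2 = (p ^ 2 + P ^ 2) *
      ((v 0 - s 0) ^ 2 + (v 1 - s 1) ^ 2) - (p * (v 0 - s 0) + P * (v 1 - s 1)) ^ 2 := by ring
    rw [this, hpP]
    linarith
  have := pow_eq_zero_iff two_ne_zero |>.mp (le_antisymm hz (sq_nonneg _))
  linarith

/-- The refraction parameter can be computed from any point on the first leg of the path. -/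
theorem ACMComputable.of_direction {p P W : ℝ} {v : Plane} (hpP : p ^ 2 + P ^ 2 = 1)
    (hW : 50 * p ^ 2 = 49 + W) (hv : v ≠ !₂[27, 2]) (hdir : p * (v 1 - 2) = P * (v 0 - 27))
    (h0 : ACMComputable (v 0)) (h1 : ACMComputable (v 1)) : ACMComputable W := by
  have hpos : (v 0 - 27) ^ 2 + (v 1 - 2) ^ 2 ≠ 0 := by
    intro h
    apply hv
    have e0 : v 0 = 27 := by
      have : (v 0 - 27) ^ 2 = 0 := by linarith [sq_nonneg (v 0 - 27), sq_nonneg (v 1 - 2)]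
      linarith [pow_eq_zero_iff two_ne_zero |>.mp this]
    have e1 : v 1 = 2 := by
      have : (v 1 - 2) ^ 2 = 0 := by linarith [sq_nonneg (v 0 - 27), sq_nonneg (v 1 - 2)]
      linarith [pow_eq_zero_iff two_ne_zero |>.mp this]
    ext i
    fin_cases i
    · exact e0
    · exact e1
  have hWv : W = 50 * ((v 0 - 27) ^ 2 / ((v 0 - 27) ^ 2 + (v 1 - 2) ^ 2)) - 49 := by
    have : (v 0 - 27) ^ 2 / ((v 0 - 27) ^ 2 + (v 1 - 2) ^ 2) = p ^ 2 := by
      rw [div_eq_iff hpos]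
      linear_combination -(v 0 - 27) ^ 2 * hpP - (p * (v 1 - 2) + P * (v 0 - 27)) * hdir
    rw [this]
    linarith
  rw [hWv]
  unfold ACMComputable at *
  push_cast
  have hx' := sub_mem h0 (ofNat_mem (solvableByRad ℚ ℂ) 27)
  have hy' := sub_mem h1 (ofNat_mem (solvableByRad ℚ ℂ) 2)
  exact sub_mem (mul_mem (ofNat_mem _ 50)
    (div_mem (pow_mem hx' 2) (add_mem (pow_mem hx' 2) (pow_mem hy' 2)))) (ofNat_mem _ 49)

/-! ### The instance -/

/-- For a region that lies in the quadrant and contains a large square at its corner, the shortest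
path from `(27, 2)` to `(-1, -6)` is polygonal, but its vertices cannot be computed by radicals. -/
theorem shortestChain_not_solvable {R : Set Plane}
    (hR₁ : ∀ x : Plane, 0 < x 0 → x 0 < 100 → -100 < x 1 → x 1 < 0 → x ∈ interior R)
    (hR₂ : ∀ x ∈ interior R, 0 < x 0 ∧ x 1 < 0) :
    (∃ L, IsShortestChain R (7 / 5) !₂[27, 2] !₂[-1, -6] L) ∧
      ¬ SolvableInACM R (7 / 5) !₂[27, 2] !₂[-1, -6] := by
  obtain ⟨p, q, P, Q, W, hp, hq, hP, hQ, hpP, hqQ, hpq, hk, hk0, hW, hnot⟩ :=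
    exists_refraction_parameters
  have hα : (1 : ℝ) ≤ 7 / 5 := by norm_num
  have hcal : Calibrates R (7 / 5) (potential p q P Q 100) := fun γ a b hab ⟨K, hK⟩ =>
    potential_sub_le_integral (by norm_num) hα hpP hqQ hpq hR₁ hab hK
  set s : Plane := !₂[27, 2] with hs
  set t : Plane := !₂[-1, -6] with ht
  -- The first leg meets the top edge at m and the last leg leaves the left edge at n. The
  -- refraction equation says exactly that m - n = k (p, q), so the middle leg has the required
  -- direction.
  set k := 27 / p - 2 / P with hkdef
  set m : Plane := !₂[p * k, 0] with hm
  set n : Plane := !₂[0, -(q * k)] with hn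
  have s0 : s 0 = 27 := rfl
  have s1 : s 1 = 2 := rfl
  have t0 : t 0 = -1 := rfl
  have t1 : t 1 = -6 := rfl
  have m0 : m 0 = p * k := rfl
  have m1 : m 1 = 0 := rfl
  have n0 : n 0 = 0 := rfl
  have n1 : n 1 = -(q * k) := rfl
  have hpk : p * k = 27 - 2 * (p / P) := by rw [hkdef]; field_simp
  have hqk : q * k = 6 - q / Q := by rw [hk]; field_simp
  have hpk0 : 0 < p * k := mul_pos hp hk0
  have hqk0 : 0 < q * k := mul_pos hq hk0
  have hpk1 : p * k < 100 := by
    have : 0 < p / P := div_pos hp hP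
    linarith
  have hqk1 : q * k < 100 := by
    have : 0 < q / Q := div_pos hq hQ
    linarith
  have w₁ : ∀ τ ∈ Ioo (0 : ℝ) 1, regionWeight R (7 / 5) (AffineMap.lineMap s m τ) = 1 := by
    intro τ hτ
    refine regionWeight_of_notMem hα fun h => ?_
    have := (hR₂ _ h).2
    rw [lineMap_coord, s1, m1] at this
    linarith [hτ.2]
  have w₂ : ∀ τ ∈ Ioo (0 : ℝ) 1, regionWeight R (7 / 5) (AffineMap.lineMap m n τ) = 7 / 5 := by
    intro τ ⟨h0, h1⟩
    apply regionWeight_of_mem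
    have a1 := mul_pos hpk0 h0
    have a2 := mul_pos hpk0 (sub_pos.mpr h1)
    have a3 := mul_pos hqk0 h0
    have a4 := mul_pos hqk0 (sub_pos.mpr h1)
    apply hR₁ <;> simp only [lineMap_coord, m0, m1, n0, n1] <;> linarith
  have w₃ : ∀ τ ∈ Ioo (0 : ℝ) 1, regionWeight R (7 / 5) (AffineMap.lineMap n t τ) = 1 := by
    intro τ hτ
    refine regionWeight_of_notMem hα fun h => ?_
    have := (hR₂ _ h).1
    rw [lineMap_coord, n0, t0] at this
    linarith [hτ.1]
  have norm_of_sq : ∀ {v : Plane} {r : ℝ}, 0 ≤ r → v 0 ^ 2 + v 1 ^ 2 = r ^ 2 → ‖v‖ = r := by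
    intro v r hr h
    rw [Plane.norm_eq, h, Real.sqrt_sq hr]
  have l₁ : ‖m - s‖ = 2 / P := by
    apply norm_of_sq (by positivity)
    simp only [PiLp.sub_apply, m0, m1, s0, s1, hpk]
    field_simp
    linear_combination 4 * hpP
  have l₂ : ‖n - m‖ = 7 / 5 * k := by
    apply norm_of_sq (by positivity)
    simp only [PiLp.sub_apply, m0, m1, n0, n1]
    linear_combination k ^ 2 * hpq
  have l₃ : ‖t - n‖ = 1 / Q := by
    apply norm_of_sq (by positivity)
    simp only [PiLp.sub_apply, t0, t1, n0, n1, hqk]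
    field_simp
    linear_combination hqQ
  have hlen : 1 * ‖m - s‖ + 7 / 5 * ‖n - m‖ + 1 * ‖t - n‖ =
      potential p q P Q 100 t - potential p q P Q 100 s := by
    rw [l₁, l₂, l₃]
    simp only [potential, s0, s1, t0, t1]
    norm_num
    have e1 : 49 / 25 * k = p * (p * k) + q * (q * k) := by linear_combination -k * hpq
    have e2 : p * (p / P) = 1 / P - P := by field_simp; linarith
    have e3 : q * (q / Q) = 1 / Q - Q := by field_simp; linarith
    rw [hpk, hqk] at e1
    rw [one_div] at e2 e3
    have e4 : 2 / P = 2 * P⁻¹ := by ring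
    rw [e4]
    linarith
  have hmin : weightedLength R (7 / 5) (threeSegments s m n t) =
      potential p q P Q 100 t - potential p q P Q 100 s := by
    rw [weightedLength_threeSegments hα w₁ w₂ w₃, hlen]
  refine ⟨⟨[s, m, n, t], rfl, rfl, fun γ hγ => ?_⟩, ?_⟩
  · have : chainLength R (7 / 5) [s, m, n, t] =
        potential p q P Q 100 t - potential p q P Q 100 s := by
      simp only [chainLength]
      rw [weightedLength_segment_of_const w₁, weightedLength_segment_of_const w₂,
        weightedLength_segment_of_const w₃, ← hlen]
      ring
    rw [this]
    exact hcal.sub_le_weightedLength hγ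
  · rintro ⟨L, hL, hcomp⟩
    obtain ⟨l, rfl⟩ : ∃ l, L = s :: l := by
      cases L with
      | nil => exact absurd hL.head_eq (by simp)
      | cons a l => exact ⟨l, by rw [Option.some_inj.mp (by simpa using hL.head_eq : some a = some s)]⟩
    have hst : s ≠ t := fun h => by
      have := congrArg (fun z : Plane => z 0) h
      simp only [s0, t0] at this
      norm_num at this
    -- Comparison with the refracted path shows that L attains the calibration bound, so its first
    -- nontrivial segment is tight.
    have hle := hL.le_length _ (isPathFromTo_threeSegments s m n t)
    rw [hmin] at hle
    obtain ⟨v, hv, hvs, htight⟩ := hcal.exists_tight_segment hst l hL.last_eq hle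
    have hdir := direction_of_tight_segment hα hpP (fun x hx => (hR₂ x hx).2) hcal
      (by rw [s0]; norm_num) (by rw [s0]; norm_num) (by rw [s1]; norm_num) htight
    rw [s0, s1] at hdir
    have hvmem := hcomp v (List.mem_cons_of_mem _ hv)
    apply hnot
    exact ACMComputable.of_direction hpP hW hvs hdir (hvmem 0) (hvmem 1)

theorem continuous_coord (i : Fin 2) : Continuous fun x : Plane => x i :=
  (EuclideanSpace.proj i : Plane →L[ℝ] ℝ).continuous

/-- An interior point can be pushed slightly left and slightly up without leaving R, which makes
both inequalities strict. -/
theorem interior_quadrant_subset {R : Set Plane} (hR : R ⊆ quadrant 0) :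
    ∀ x ∈ interior R, 0 < x 0 ∧ x 1 < 0 := by
  intro x hx
  have move : ∀ u : Plane, ∃ ε : ℝ, 0 < ε ∧ x + ε • u ∈ R := by
    intro u
    have hc : ContinuousAt (fun ε : ℝ => x + ε • u) 0 := by fun_prop
    have hmem : interior R ∈ nhds (x + (0 : ℝ) • u) := by
      simpa using isOpen_interior.mem_nhds hx
    have hev : ∀ᶠ ε : ℝ in nhdsWithin 0 (Ioi 0), x + ε • u ∈ interior R :=
      (hc.eventually hmem).filter_mono nhdsWithin_le_nhds
    obtain ⟨ε, h1, h2⟩ := (hev.and self_mem_nhdsWithin).exists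
    exact ⟨ε, h2, interior_subset h1⟩
  constructor
  · obtain ⟨ε, hε, h⟩ := move !₂[-1, 0]
    have := (hR h).1
    simp at this
    linarith
  · obtain ⟨ε, hε, h⟩ := move !₂[0, 1]
    have := (hR h).2
    simp at this
    linarith

theorem mem_interior_of_openSquare_subset {R : Set Plane} {M : ℝ}
    (hR : ∀ x : Plane, 0 < x 0 → x 0 < M → -M < x 1 → x 1 < 0 → x ∈ R) :
    ∀ x : Plane, 0 < x 0 → x 0 < M → -M < x 1 → x 1 < 0 → x ∈ interior R := by
  intro x h0 h1 h2 h3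
  rw [mem_interior]
  refine ⟨{x | 0 < x 0} ∩ {x | x 0 < M} ∩ {x | -M < x 1} ∩ {x | x 1 < 0},
    fun y hy => hR y hy.1.1.1 hy.1.1.2 hy.1.2 hy.2, ?_, ⟨⟨⟨h0, h1⟩, h2⟩, h3⟩⟩
  exact (((isOpen_lt continuous_const (continuous_coord 0)).inter
    (isOpen_lt (continuous_coord 0) continuous_const)).inter
    (isOpen_lt continuous_const (continuous_coord 1))).inter
    (isOpen_lt (continuous_coord 1) continuous_const)

end

theorem theorem2 :
    (∃ (α : ℚ) (O s t : ℚ × ℚ),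
      0 < (α : ℝ) ∧ (α : ℝ) < √2 ∧ α ≠ 1 ∧
      ratPoint s ∉ quadrant (ratPoint O) ∧ ratPoint t ∉ quadrant (ratPoint O) ∧
      (∃ L, IsShortestChain (quadrant (ratPoint O)) α (ratPoint s) (ratPoint t) L) ∧
      ¬ SolvableInACM (quadrant (ratPoint O)) α (ratPoint s) (ratPoint t)) ∧
    (∃ (α : ℚ) (A B s t : ℚ × ℚ),
      0 < (α : ℝ) ∧ (α : ℝ) < √2 ∧ α ≠ 1 ∧ A.1 < B.1 ∧ A.2 < B.2 ∧
      ratPoint s ∉ rectangle (ratPoint A) (ratPoint B) ∧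
      ratPoint t ∉ rectangle (ratPoint A) (ratPoint B) ∧
      (∃ L, IsShortestChain (rectangle (ratPoint A) (ratPoint B)) α (ratPoint s) (ratPoint t) L) ∧
      ¬ SolvableInACM (rectangle (ratPoint A) (ratPoint B)) α (ratPoint s) (ratPoint t)) := by
  have hα : ((7 / 5 : ℚ) : ℝ) = 7 / 5 := by norm_num
  have hs : ratPoint (27, 2) = !₂[27, 2] := by simp [ratPoint]
  have ht : ratPoint (-1, -6) = !₂[-1, -6] := by simp [ratPoint]
  have hO : ratPoint (0, 0) = 0 := by
    ext i
    fin_cases i <;> simp [ratPoint]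
  have hsqrt : (7 / 5 : ℝ) < √2 := Real.lt_sqrt_of_sq_lt (by norm_num)
  constructor
  · refine ⟨7 / 5, (0, 0), (27, 2), (-1, -6), ?_⟩
    rw [hα, hs, ht, hO]
    refine ⟨by norm_num, hsqrt, by norm_num, ?_, ?_, ?_⟩
    · intro h
      have := h.2
      simp at this
      linarith
    · intro h
      have := h.1
      simp at this
      linarith
    · apply shortestChain_not_solvable
      · apply mem_interior_of_openSquare_subset
        intro x h0 _ _ h3
        exact ⟨h0.le, h3.le⟩
      · exact interior_quadrant_subset subset_rfl
  · refine ⟨7 / 5, (0, -100), (100, 0), (27, 2), (-1, -6), ?_⟩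
    rw [hα, hs, ht]
    have hmem : ∀ x : Plane, x ∈ rectangle (ratPoint (0, -100)) (ratPoint (100, 0)) ↔
        0 ≤ x 0 ∧ x 0 ≤ 100 ∧ -100 ≤ x 1 ∧ x 1 ≤ 0 := by
      intro x
      simp [rectangle, ratPoint]
    refine ⟨by norm_num, hsqrt, by norm_num, by norm_num, by norm_num, ?_, ?_, ?_⟩
    · rw [hmem]
      intro h
      have := h.2.2.2
      simp at this
      linarith
    · rw [hmem]
      intro h
      have := h.1
      simp at this
      linarith
    · apply shortestChain_not_solvable
      · apply mem_interior_of_openSquare_subset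
        intro x h0 h1 h2 h3
        exact (hmem x).mpr ⟨h0.le, h1.le, h2.le, h3.le⟩
      · apply interior_quadrant_subset
        intro x hx
        exact ⟨((hmem x).mp hx).1, ((hmem x).mp hx).2.2.2⟩
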